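/- Let $n,m\in\mathbb N$, $T\in\mathbb R$, $-\infty\le\bar T<T$, and let $A(t),C(t)\in\mathbb R^{n\times n}$, $\sigma(t)\in\mathbb R^{n\times m}$, $\Sigma(t)=\sigma(t)\sigma(t)'$, where $C(t)$ is symmetric, $A,C,\Sigma$ are piecewise continuous and locally bounded on $(\bar T,T]$, and $\sigma$ is measurable. For $t_1\le t_2$ in $(\bar T,T]$ and a control $u\in L_2(t_1,t_2)$, a trajectory under $u$ is an absolutely continuous solution of $\dot x_t=A(t)x_t+\sigma(t)u_t$ for a.e. $t\in[t_1,t_2]$; it is determined by $u$ and either its initial value $x_{t_1}$ or its final value $x_{t_2}$ (in the latter case it is called the backward trajectory ending at $x_{t_2}$). Assume controllability: for all $\bar T<t_1<t_2\le T$ and $x,y\in\mathbb R^n$ some $u\in L_2(t_1,t_2)$ has a trajectory with $x_{t_1}=x$, $x_{t_2}=y$. Put $l_t(x,u)=\tfrac12x'C(t)x-\tfrac12|u|^2$. Let $P,S,Q\in\mathbb R^{n\times n}$ with $P,Q$ symmetric and $S$ invertible be such that the Riccati equation $-\dot p=A'p+pA+C+p\Sigma p$, $p(T)=P$, has a symmetric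 solution on $(\bar T,T]$ (continuous and satisfying the equation in integrated form); call such $(P,S,Q)$ admissible. For $z\in\mathbb R^n$ put $\phi^z(x)=\tfrac12x'Px+x'Sz+\tfrac12z'Qz$ and, for $t\in(\bar T,T]$, $$V^z_t(x)=\sup_{u\in L_2(t,T)}\Big\{\int_t^T l_s(x_s,u_s)\,ds+\phi^z(x_T)\Big\},\qquad x_t=x .$$ For $t_1\le t_2$ in $(\bar T,T]$ let $$I_{t_1}^{t_2}(x,y)=\sup\Big\{\int_{t_1}^{t_2}l_t(x_t,u_t)\,dt : u\in L_2(t_1,t_2),\ x_{t_1}=x,\ x_{t_2}=y\Big\}$$ ($-\infty$ if there is no such $u$), and for $\varphi:\mathbb R^n\to[-\infty,\infty]$ let $$\mathcal S_{t_1}^{t_2}[\varphi](x)=\sup_{u\in L_2(t_1,t_2)}\Big\{\int_{t_1}^{t_2}l_t(x_t,u_t)\,dt+\varphi(x_{t_2})\Big\},\quad x_{t_1}=x,$$ $$\mathcal S_{t_2}^{t_1}[\varphi](y)=\inf_{u\in L_2(t_1,t_2)}\Big\{-\int_{t_1}^{t_2}l_t(x_t,u_t)\,dt+\varphi(x_{t_1})\Big\},\quad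 x_{t_2}=y\ \text{(backward trajectories)}.$$ **Theorem (backward dynamic programming principle).** Let $\bar T<t_1<t_2\le T$. For every admissible $(P,S,Q)$ and every $z\in\mathbb R^n$, the functions $V^z_{t_1},V^z_{t_2},I_{t_1}^{t_2}$ are finite and, for all $y\in\mathbb R^n$, $$V^z_{t_2}(y)=\inf_{u\in L_2(t_1,t_2)}\Big\{-\int_{t_1}^{t_2}l_t(x_t,u_t)\,dt+V^z_{t_1}(x_{t_1})\Big\}=\inf_{x\in\mathbb R^n}\big(V^z_{t_1}(x)-I_{t_1}^{t_2}(x,y)\big),$$ where $x_t$ is the backward trajectory with $x_{t_2}=y$; that is, $V^z_{t_2}=\mathcal S_{t_2}^{t_1}[V^z_{t_1}]$. Moreover $V^z_{t_2}=\mathcal S_{t_2}^{t_1}\big[\mathcal S_{t_1}^{t_2}[V^z_{t_2}]\big]$. Consequently $\mathcal S_{t_1}^{t_2}=(\mathcal S_{t_2}^{t_1})^{-1}$ on value functions: if $\mathcal V_t$ denotes the set of all functions $V^z_t$ ($(P,S,Q)$ admissible, $z\in\mathbb R^n$), then $\mathcal S_{t_1}^{t_2}$ maps $\mathcal V_{t_2}$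 into $\mathcal V_{t_1}$, $\mathcal S_{t_2}^{t_1}$ maps $\mathcal V_{t_1}$ into $\mathcal V_{t_2}$, and these two maps are inverse to each other. -/

import Mathlib

open MeasureTheory Set Matrix

noncomputable section

/-- The data of the linear-quadratic optimal control problem: dynamics
`x' = A(t) x + σ(t) u` with state in `ℝⁿ`, control in `ℝᵐ`, and running payoff
`½ x' C(t) x - ½ |u|²`. -/
structure LQSystem (n m : ℕ) where
  A : ℝ → Matrix (Fin n) (Fin n) ℝ
  C : ℝ → Matrix (Fin n) (Fin n) ℝ
  σ : ℝ → Matrix (Fin n) (Fin m) ℝ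

/-- The time interval `(Tbar, T]`, where `Tbar = -∞` is allowed. -/
def timeInterval (Tbar : EReal) (T : ℝ) : Set ℝ := {t | Tbar < (t : EReal) ∧ t ≤ T}

/-- Piecewise continuity on `(Tbar, T]`: only finitely many discontinuities in each compact
subinterval. (One-sided limits at the discontinuities are not required.) -/
def PiecewiseContinuousOn {n : ℕ} (F : ℝ → Matrix (Fin n) (Fin n) ℝ)
    (Tbar : EReal) (T : ℝ) : Prop :=
  ∀ a : ℝ, Tbar < (a : EReal) → {t ∈ Icc a T | ¬ ContinuousWithinAt F (Icc a T) t}.Finite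

/-- Local boundedness on `(Tbar, T]`: boundedness on each compact subinterval. -/
def LocallyBoundedOn {n : ℕ} (F : ℝ → Matrix (Fin n) (Fin n) ℝ)
    (Tbar : EReal) (T : ℝ) : Prop :=
  ∀ a : ℝ, Tbar < (a : EReal) → ∃ K : ℝ, ∀ t ∈ Icc a T, ∀ i j, |F t i j| ≤ K

namespace LQSystem

variable {n m : ℕ} (D : LQSystem n m)

/-- `Σ(t) = σ(t) σ(t)'`; it is automatically symmetric positive semidefinite. -/
def Sig (t : ℝ) : Matrix (Fin n) (Fin n) ℝ := D.σ t * (D.σ t)ᵀ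

/-- The running payoff `l_t(x, u) = ½ x' C(t) x - ½ |u|²` (`|u|` the Euclidean norm). -/
def l (t : ℝ) (x : Fin n → ℝ) (u : Fin m → ℝ) : ℝ :=
  1 / 2 * (x ⬝ᵥ (D.C t *ᵥ x)) - 1 / 2 * (u ⬝ᵥ u)

/-- `ξ` is a trajectory on `[t₁, t₂]` under the control `u ∈ L²(t₁, t₂)`: a continuous
(hence absolutely continuous) function which solves `ξ' = A ξ + σ u` a.e. on `[t₁, t₂]`,
written in integrated form. With `ξ t₁ = x` prescribed it is the forward
trajectory from `x`, with `ξ t₂ = y` prescribed the backward trajectory ending at `y`. -/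
def IsTrajectory (t₁ t₂ : ℝ) (u : ℝ → Fin m → ℝ) (ξ : ℝ → Fin n → ℝ) : Prop :=
  MemLp u 2 (volume.restrict (Ioc t₁ t₂)) ∧
  ContinuousOn ξ (Icc t₁ t₂) ∧
  ∀ t ∈ Icc t₁ t₂, ξ t = ξ t₁ + ∫ s in t₁..t, (D.A s *ᵥ ξ s + D.σ s *ᵥ u s)

/-- The accumulated running payoff `∫_{t₁}^{t₂} l_t(x_t, u_t) dt`. -/
def runningPayoff (t₁ t₂ : ℝ) (u : ℝ → Fin m → ℝ) (ξ : ℝ → Fin n → ℝ) : ℝ :=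
  ∫ t in t₁..t₂, D.l t (ξ t) (u t)

/-- `p` solves on `(Tbar, T]` the Riccati equation `-p' = A' p + p A + C + p Σ p`, `p(T) = P`
(in integrated form, entry by entry), with symmetric values. -/
def IsRiccatiSolution (Tbar : EReal) (T : ℝ) (P : Matrix (Fin n) (Fin n) ℝ)
    (p : ℝ → Matrix (Fin n) (Fin n) ℝ) : Prop :=
  ContinuousOn p (timeInterval Tbar T) ∧
  (∀ t ∈ timeInterval Tbar T, (p t).IsSymm) ∧
  ∀ t ∈ timeInterval Tbar T, ∀ i j,
    p t i j = P i j + ∫ s in t..T,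
      ((D.A s)ᵀ * p s + p s * D.A s + D.C s + p s * D.Sig s * p s) i j

/-- The standing assumptions on the system (those not involving the terminal payoff). -/
structure StandingAssumptions (Tbar : EReal) (T : ℝ) : Prop where
  C_symm : ∀ t ∈ timeInterval Tbar T, (D.C t).IsSymm
  A_pc : PiecewiseContinuousOn D.A Tbar T
  C_pc : PiecewiseContinuousOn D.C Tbar T
  Sig_pc : PiecewiseContinuousOn D.Sig Tbar T
  A_bdd : LocallyBoundedOn D.A Tbar T
  C_bdd : LocallyBoundedOn D.C Tbar T
  Sig_bdd : LocallyBoundedOn D.Sig Tbar T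
  σ_meas : ∀ i j, AEMeasurable (fun t => D.σ t i j) (volume.restrict (timeInterval Tbar T))
  controllable : ∀ t₁ t₂ : ℝ, Tbar < (t₁ : EReal) → t₁ < t₂ → t₂ ≤ T →
    ∀ x y : Fin n → ℝ, ∃ u ξ, D.IsTrajectory t₁ t₂ u ξ ∧ ξ t₁ = x ∧ ξ t₂ = y

/-- The assumptions on the parameters of the terminal payoff: `P`, `Q` symmetric, `S` invertible,
and the Riccati equation with terminal value `P` has a solution on `(Tbar, T]`. -/
def IsTerminalData (Tbar : EReal) (T : ℝ) (P S Q : Matrix (Fin n) (Fin n) ℝ) : Prop :=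
  P.IsSymm ∧ Q.IsSymm ∧ IsUnit S.det ∧ ∃ p, D.IsRiccatiSolution Tbar T P p

end LQSystem

/-- The terminal payoff `φ^z(x) = ½ x' P x + x' S z + ½ z' Q z`. -/
def terminalPayoff {n : ℕ} (P S Q : Matrix (Fin n) (Fin n) ℝ) (z x : Fin n → ℝ) : ℝ :=
  1 / 2 * (x ⬝ᵥ (P *ᵥ x)) + x ⬝ᵥ (S *ᵥ z) + 1 / 2 * (z ⬝ᵥ (Q *ᵥ z))

namespace LQSystem

variable {n m : ℕ} (D : LQSystem n m)

/-- The value function `V^z_t(x)`: the supremum over all controls `u ∈ L²(t, T)`, with trajectory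
`ξ` starting from `ξ t = x`, of `∫_t^T l ds + φ^z(ξ T)`. -/
def value (T : ℝ) (P S Q : Matrix (Fin n) (Fin n) ℝ) (z : Fin n → ℝ) (t : ℝ)
    (x : Fin n → ℝ) : EReal :=
  ⨆ (u : ℝ → Fin m → ℝ) (ξ : ℝ → Fin n → ℝ) (_ : D.IsTrajectory t T u ξ) (_ : ξ t = x),
    ((D.runningPayoff t T u ξ + terminalPayoff P S Q z (ξ T) : ℝ) : EReal)

/-- The max-plus kernel `I_{t₁}^{t₂}(x, y)`: the supremum of `∫_{t₁}^{t₂} l dt` over all controls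
steering `x` at time `t₁` to `y` at time `t₂`; it is `-∞` if there are none. -/
def kernel (t₁ t₂ : ℝ) (x y : Fin n → ℝ) : EReal :=
  ⨆ (u : ℝ → Fin m → ℝ) (ξ : ℝ → Fin n → ℝ) (_ : D.IsTrajectory t₁ t₂ u ξ)
    (_ : ξ t₁ = x) (_ : ξ t₂ = y), ((D.runningPayoff t₁ t₂ u ξ : ℝ) : EReal)

/-- The forward semigroup `S_{t₁}^{t₂}[φ](x) = sup_u { ∫_{t₁}^{t₂} l dt + φ(x_{t₂}) }`, over
trajectories with `x_{t₁} = x`. -/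
def forwardOp (t₁ t₂ : ℝ) (φ : (Fin n → ℝ) → EReal) (x : Fin n → ℝ) : EReal :=
  ⨆ (u : ℝ → Fin m → ℝ) (ξ : ℝ → Fin n → ℝ) (_ : D.IsTrajectory t₁ t₂ u ξ) (_ : ξ t₁ = x),
    ((D.runningPayoff t₁ t₂ u ξ : ℝ) : EReal) + φ (ξ t₂)

/-- The backward operator `S_{t₂}^{t₁}[φ](y) = inf_u { -∫_{t₁}^{t₂} l dt + φ(x_{t₁}) }`, over
backward trajectories, `x_{t₂} = y`; here `t₁ ≤ t₂`. -/
def backwardOp (t₂ t₁ : ℝ) (φ : (Fin n → ℝ) → EReal) (y : Fin n → ℝ) : EReal :=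
  ⨅ (u : ℝ → Fin m → ℝ) (ξ : ℝ → Fin n → ℝ) (_ : D.IsTrajectory t₁ t₂ u ξ) (_ : ξ t₂ = y),
    ((-D.runningPayoff t₁ t₂ u ξ : ℝ) : EReal) + φ (ξ t₁)

/-- The set of all value functions at time `t`, for all admissible terminal payoffs and all `z`. -/
def valueFunctions (Tbar : EReal) (T t : ℝ) : Set ((Fin n → ℝ) → EReal) :=
  {V | ∃ (P S Q : Matrix (Fin n) (Fin n) ℝ) (z : Fin n → ℝ),
    D.IsTerminalData Tbar T P S Q ∧ V = D.value T P S Q z t}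

end LQSystem

end

/-! The proof is a completion of squares. Let p solve the Riccati equation, let g solve g' = -(A +
Σp)'g with g(T) = Sz, let c satisfy c' = -½ g'Σg with c(T) = ½ z'Qz, and put q_t(x) = ½ x'p(t)x +
x'g(t) + c(t), so that q_T = φ^z. Along every trajectory q_t(x_t) has derivative -l - ½|u - σ'(px +
g)|² (`riccati_completion_of_squares`). Hence ∫ l + q_{t₂}(x_{t₂}) ≤ q_{t₁}(x_{t₁}), with equality
under the feedback u = σ'(px + g) (`runningPayoff_add`).

This one inequality serves both directions: with x_{t₁} fixed it bounds a supremum, with x_{t₂}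
fixed an infimum. The closed-loop equation is linear with bounded coefficients, hence solvable from
either end, so both bounds are attained. Thus q_t = V^z_t, and the two operators carry q_{t₂} to
q_{t₁} and back (`forwardOp_eq`, `backwardOp_eq`). The inequality also gives I(x, y) ≤ V_{t₁}(x) -
V_{t₂}(y), with equality when x is the starting point of the optimal backward trajectory ending at
y.

The equations hold only almost everywhere, so all calculus is done on primitives of integrable
functions. -/

/-! ### Carathéodory existence -/

/-- Carathéodory existence theorem on a compact interval, initial value prescribed. -/
theorem exists_integral_equation_of_lipschitz {E : Type*} [NormedAddCommGroup E]
    [NormedSpace ℝ E] [CompleteSpace E] {F : ℝ → E → E} {a b K : ℝ} (hab : a ≤ b) (hK : 0 < K)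
    (hint : ∀ f : ℝ → E, Continuous f → IntervalIntegrable (fun s => F s (f s)) volume a b)
    (hlip : ∀ᵐ s, s ∈ Icc a b → ∀ x y, ‖F s x - F s y‖ ≤ K * ‖x - y‖) (x₀ : E) :
    ∃ ξ : ℝ → E, Continuous ξ ∧ ∀ t ∈ Icc a b, ξ t = x₀ + ∫ s in a..t, F s (ξ s) := by
  -- An exponential weight makes the Picard map a contraction on all of [a, b] at once. The unknown
  -- is η = ξ / w; since the integral of K w over [a, t] is (w(t) - 1)/2, the Lipschitz constant is
  -- 1/2 whatever the length of the interval.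
  let w : ℝ → ℝ := fun s => Real.exp (2 * K * (s - a))
  have hw : Continuous w := by fun_prop
  have hw0 : ∀ s, 0 < w s := fun s => Real.exp_pos _
  -- Extending η constantly beyond [a, b] gives a continuous function on ℝ, as `hint` requires.
  let ext : C(Icc a b, E) → ℝ → E := fun η s => w s • η (projIcc a b hab s)
  have hext : ∀ η, Continuous (ext η) := fun η =>
    hw.smul (η.continuous.comp continuous_projIcc)
  have hcont : ∀ η, Continuous fun t : Icc a b =>
      (w t)⁻¹ • (x₀ + ∫ s in a..(t : ℝ), F s (ext η s)) := by
    intro η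
    have h1 : ContinuousOn (fun t => ∫ s in a..t, F s (ext η s)) (Icc a b) := by
      have := intervalIntegral.continuousOn_primitive_interval (μ := volume)
        ((intervalIntegrable_iff' (by simp)).1 (hint _ (hext η)))
      rwa [uIcc_of_le hab] at this
    have h2 : Continuous fun t : Icc a b => ∫ s in a..(t : ℝ), F s (ext η s) :=
      continuousOn_iff_continuous_domRestrict.1 h1
    exact ((hw.comp continuous_subtype_val).inv₀ fun t => by exact (hw0 t).ne').smul
      (continuous_const.add h2)
  let Φ : C(Icc a b, E) → C(Icc a b, E) := fun η => ⟨_, hcont η⟩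
  have hΦ : ContractingWith (1 / 2) Φ := by
    refine ⟨by rw [← NNReal.coe_lt_coe]; norm_num, LipschitzWith.of_dist_le_mul fun η η' => ?_⟩
    rw [ContinuousMap.dist_le (by positivity)]
    intro t
    have hsub : uIcc a (t : ℝ) ⊆ uIcc a b := by
      rw [uIcc_of_le t.2.1, uIcc_of_le hab]; exact Icc_subset_Icc_right t.2.2
    have e1 : dist (Φ η t) (Φ η' t) =
        (w t)⁻¹ * ‖∫ s in a..(t : ℝ), (F s (ext η s) - F s (ext η' s))‖ := by
      rw [intervalIntegral.integral_sub ((hint _ (hext η)).mono_set hsub)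
        ((hint _ (hext η')).mono_set hsub), dist_eq_norm]
      simp only [Φ, ContinuousMap.coe_mk]
      rw [← smul_sub, norm_smul, Real.norm_of_nonneg (inv_nonneg.2 (hw0 _).le),
        add_sub_add_left_eq_sub]
    have e2 : ‖∫ s in a..(t : ℝ), (F s (ext η s) - F s (ext η' s))‖ ≤
        ∫ s in a..(t : ℝ), K * (w s * dist η η') := by
      refine intervalIntegral.norm_integral_le_of_norm_le t.2.1 ?_
        ((by fun_prop : Continuous fun s => K * (w s * dist η η')).intervalIntegrable _ _)
      filter_upwards [hlip] with s hs hst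
      refine (hs ⟨hst.1.le, hst.2.trans t.2.2⟩ _ _).trans ?_
      refine mul_le_mul_of_nonneg_left ?_ hK.le
      simp only [ext]
      rw [← smul_sub, norm_smul, Real.norm_of_nonneg (hw0 _).le, ← dist_eq_norm]
      exact mul_le_mul_of_nonneg_left (ContinuousMap.dist_apply_le_dist _) (hw0 _).le
    have e3 : ∫ s in a..(t : ℝ), K * (w s * dist η η') = (w t - 1) / 2 * dist η η' := by
      have hd : ∀ s ∈ uIcc a (t : ℝ), HasDerivAt (fun s => w s / 2 * dist η η')
          (K * (w s * dist η η')) s := by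
        intro s _
        have h1 : HasDerivAt (fun s => 2 * K * (s - a)) (2 * K) s := by
          simpa using ((hasDerivAt_id s).sub_const a).const_mul (2 * K)
        have h2 := (h1.exp.div_const 2).mul_const (dist η η')
        convert! h2 using 1
        simp only [w]; ring
      rw [intervalIntegral.integral_eq_sub_of_hasDerivAt hd
        ((by fun_prop : Continuous fun s => K * (w s * dist η η')).intervalIntegrable _ _)]
      simp only [w, sub_self, mul_zero, Real.exp_zero]; ring
    rw [e1]
    calc (w t)⁻¹ * _ ≤ (w t)⁻¹ * ((w t - 1) / 2 * dist η η') :=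
          mul_le_mul_of_nonneg_left (e2.trans e3.le) (inv_nonneg.2 (hw0 _).le)
      _ ≤ (w t)⁻¹ * (w t / 2 * dist η η') := by
          refine mul_le_mul_of_nonneg_left ?_ (inv_nonneg.2 (hw0 _).le)
          exact mul_le_mul_of_nonneg_right (by linarith) dist_nonneg
      _ = _ := by
          have := (hw0 t).ne'
          push_cast
          field_simp
  obtain ⟨η, hη, -⟩ := hΦ.exists_fixedPoint 0 (edist_ne_top _ _)
  refine ⟨ext η, hext η, fun t ht => ?_⟩
  have h := congrArg (fun f : C(Icc a b, E) => w t • f ⟨t, ht⟩) hη.symm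
  simp only [Φ, ContinuousMap.coe_mk] at h
  rw [smul_inv_smul₀ (hw0 t).ne'] at h
  rw [← h]
  simp only [ext, projIcc_of_mem hab ht]

/-- Carathéodory existence theorem on a compact interval, final value prescribed. -/
theorem exists_integral_equation_of_lipschitz_final {E : Type*} [NormedAddCommGroup E]
    [NormedSpace ℝ E] [CompleteSpace E] {F : ℝ → E → E} {a b K : ℝ} (hab : a ≤ b) (hK : 0 < K)
    (hint : ∀ f : ℝ → E, Continuous f → IntervalIntegrable (fun s => F s (f s)) volume a b)
    (hlip : ∀ᵐ s, s ∈ Icc a b → ∀ x y, ‖F s x - F s y‖ ≤ K * ‖x - y‖) (y₀ : E) :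
    ∃ ξ : ℝ → E, Continuous ξ ∧ ξ b = y₀ ∧
      ∀ t ∈ Icc a b, ξ t = ξ a + ∫ s in a..t, F s (ξ s) := by
  -- The reflection s ↦ a + b - s turns the final value problem into an initial value problem for
  -- -F(a + b - s, ·); it preserves Lebesgue measure, hence also the almost everywhere Lipschitz
  -- bound.
  have hint' : ∀ f : ℝ → E, Continuous f →
      IntervalIntegrable (fun s => -F (a + b - s) (f s)) volume a b := by
    intro f hf
    have h := ((hint (fun s => f (a + b - s)) (by fun_prop)).comp_sub_left (a + b)).symm
    simp only [sub_sub_cancel, add_sub_cancel_right, add_sub_cancel_left] at h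
    exact h.neg
  have hlip' : ∀ᵐ s, s ∈ Icc a b →
      ∀ x y, ‖-F (a + b - s) x - -F (a + b - s) y‖ ≤ K * ‖x - y‖ := by
    filter_upwards [(Measure.measurePreserving_sub_left volume (a + b)).quasiMeasurePreserving.ae hlip]
      with s hs hmem x y
    have := hs ⟨by linarith [hmem.2], by linarith [hmem.1]⟩ y x
    rwa [neg_sub_neg, norm_sub_rev x y]
  obtain ⟨η, hη, he⟩ := exists_integral_equation_of_lipschitz hab hK hint' hlip' y₀
  let ξ : ℝ → E := fun t => η (a + b - t)
  have hξ : Continuous ξ := by fun_prop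
  have h1 : ∀ t ∈ Icc a b, ξ t = y₀ - ∫ s in t..b, F s (ξ s) := by
    intro t ht
    have h := he (a + b - t) ⟨by linarith [ht.2], by linarith [ht.1]⟩
    have h2 := intervalIntegral.integral_comp_sub_left (a := a) (b := a + b - t)
      (fun s => F s (ξ s)) (a + b)
    simp only [ξ, sub_sub_cancel, add_sub_cancel_left] at h2
    rw [intervalIntegral.integral_neg, h2, ← sub_eq_add_neg] at h
    exact h
  refine ⟨ξ, hξ, by simpa using h1 b (right_mem_Icc.2 hab), fun t ht => ?_⟩
  have hI := hint ξ hξ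
  have hi1 : IntervalIntegrable (fun s => F s (ξ s)) volume a t :=
    hI.mono_set (by rw [uIcc_of_le ht.1, uIcc_of_le hab]; exact Icc_subset_Icc_right ht.2)
  have hi2 : IntervalIntegrable (fun s => F s (ξ s)) volume t b :=
    hI.mono_set (by rw [uIcc_of_le ht.2, uIcc_of_le hab]; exact Icc_subset_Icc_left ht.1)
  rw [h1 t ht, h1 a (left_mem_Icc.2 hab), ← intervalIntegral.integral_add_adjacent_intervals hi1 hi2]
  abel

/-! ### Calculus of primitives -/

/-- `F` is the primitive on `[a, b]` of the integrable function `f`. -/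
def IsPrimitiveOn (F f : ℝ → ℝ) (a b : ℝ) : Prop :=
  IntervalIntegrable f volume a b ∧ ∀ t ∈ Icc a b, F t = F a + ∫ s in a..t, f s

namespace IsPrimitiveOn

variable {F G f g : ℝ → ℝ} {a b : ℝ}

theorem const (c a b : ℝ) : IsPrimitiveOn (fun _ => c) (fun _ => 0) a b :=
  ⟨by simp, by simp⟩

theorem intervalIntegrable_of_mem (hF : IsPrimitiveOn F f a b) {s t : ℝ} (hs : s ∈ Icc a b)
    (ht : t ∈ Icc a b) : IntervalIntegrable f volume s t := by
  refine hF.1.mono_set ?_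
  rw [uIcc_of_le (hs.1.trans hs.2)]
  exact uIcc_subset_Icc hs ht

theorem sub_eq (hF : IsPrimitiveOn F f a b) {s t : ℝ} (hs : s ∈ Icc a b) (ht : t ∈ Icc a b) :
    F t - F s = ∫ r in s..t, f r := by
  have ha : a ∈ Icc a b := left_mem_Icc.2 (hs.1.trans hs.2)
  rw [hF.2 t ht, hF.2 s hs, ← intervalIntegral.integral_interval_sub_left
    (hF.intervalIntegrable_of_mem ha ht) (hF.intervalIntegrable_of_mem ha hs)]
  ring

theorem mono (hF : IsPrimitiveOn F f a b) {a' b' : ℝ} (ha : a ≤ a') (hab : a' ≤ b')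
    (hb : b' ≤ b) : IsPrimitiveOn F f a' b' := by
  have ha' : a' ∈ Icc a b := ⟨ha, hab.trans hb⟩
  refine ⟨hF.intervalIntegrable_of_mem ha' ⟨ha.trans hab, hb⟩, fun t ht => ?_⟩
  rw [← hF.sub_eq ha' ⟨ha.trans ht.1, ht.2.trans hb⟩]
  ring

theorem add (hF : IsPrimitiveOn F f a b) (hG : IsPrimitiveOn G g a b) :
    IsPrimitiveOn (fun t => F t + G t) (fun t => f t + g t) a b := by
  refine ⟨hF.1.add hG.1, fun t ht => ?_⟩
  have ha : a ∈ Icc a b := left_mem_Icc.2 (ht.1.trans ht.2)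
  rw [intervalIntegral.integral_add (hF.intervalIntegrable_of_mem ha ht)
    (hG.intervalIntegrable_of_mem ha ht)]
  simp only [hF.2 t ht, hG.2 t ht]
  ring

theorem const_mul (hF : IsPrimitiveOn F f a b) (c : ℝ) :
    IsPrimitiveOn (fun t => c * F t) (fun t => c * f t) a b := by
  refine ⟨hF.1.const_mul c, fun t ht => ?_⟩
  simp only [intervalIntegral.integral_const_mul, hF.2 t ht]
  ring

theorem sum {ι : Type*} (s : Finset ι) {F f : ι → ℝ → ℝ}
    (h : ∀ i ∈ s, IsPrimitiveOn (F i) (f i) a b) :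
    IsPrimitiveOn (fun t => ∑ i ∈ s, F i t) (fun t => ∑ i ∈ s, f i t) a b := by
  classical
  induction s using Finset.induction_on with
  | empty => simpa using const 0 a b
  | insert i s his ih =>
    simp only [Finset.sum_insert his]
    exact (h i (by simp)).add (ih fun j hj => h j (by simp [hj]))

theorem continuousOn (hF : IsPrimitiveOn F f a b) : ContinuousOn F (Icc a b) := by
  rcases lt_or_ge b a with hab | hab
  · simp [Icc_eq_empty_of_lt hab]
  have := intervalIntegral.continuousOn_primitive_interval (μ := volume)
    ((intervalIntegrable_iff' (by simp)).1 hF.1)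
  rw [uIcc_of_le hab] at this
  exact (continuousOn_const.add this).congr hF.2

/-- Integration by parts for absolutely continuous functions. -/
theorem mul (hab : a ≤ b) (hF : IsPrimitiveOn F f a b) (hG : IsPrimitiveOn G g a b) :
    IsPrimitiveOn (fun t => F t * G t) (fun t => f t * G t + F t * g t) a b := by
  have hu := uIcc_of_le hab
  refine ⟨(hF.1.mul_continuousOn (hu ▸ hG.continuousOn)).add
    (hG.1.continuousOn_mul (hu ▸ hF.continuousOn)), fun t ht => ?_⟩
  have hut := uIcc_of_le ht.1
  have hF' := hF.mono le_rfl ht.1 ht.2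
  have hG' := hG.mono le_rfl ht.1 ht.2
  -- `F` is controlled only on [a, b], so it is replaced by F(a) + ∫ f, which is absolutely
  -- continuous and has derivative f almost everywhere.
  have ac : ∀ {H h : ℝ → ℝ}, IsPrimitiveOn H h a t →
      AbsolutelyContinuousOnInterval (fun s => H a + ∫ r in a..s, h r) a t := fun hH =>
    ((LipschitzWith.const (_ : ℝ)).lipschitzOnWith.absolutelyContinuousOnInterval).add
      (hH.1.absolutelyContinuousOnInterval_intervalIntegral (c := a) (by simp))
  have key := (ac hF').integral_deriv_mul_eq_sub (ac hG')
  have hcongr : ∫ x in a..t, (f x * G x + F x * g x) =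
      ∫ x in a..t, (deriv (fun s => F a + ∫ r in a..s, f r) x * (G a + ∫ r in a..x, g r) +
        (F a + ∫ r in a..x, f r) * deriv (fun s => G a + ∫ r in a..s, g r) x) := by
    refine intervalIntegral.integral_congr_ae ?_
    filter_upwards [hF'.1.ae_hasDerivAt_integral, hG'.1.ae_hasDerivAt_integral]
      with x hx hy hxt
    have hxu : x ∈ uIcc a t := uIoc_subset_uIcc hxt
    rw [((hx hxu a (by simp)).const_add (F a)).deriv, ((hy hxu a (by simp)).const_add (G a)).deriv,
      ← hF'.2 x (hut ▸ hxu), ← hG'.2 x (hut ▸ hxu)]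
  rw [hcongr, key, ← hF.2 t ht, ← hG.2 t ht]
  simp

end IsPrimitiveOn

theorem IsPrimitiveOn.dotProduct {k : ℕ} {v w v' w' : ℝ → Fin k → ℝ} {a b : ℝ} (hab : a ≤ b)
    (hv : ∀ i, IsPrimitiveOn (fun t => v t i) (fun t => v' t i) a b)
    (hw : ∀ i, IsPrimitiveOn (fun t => w t i) (fun t => w' t i) a b) :
    IsPrimitiveOn (fun t => v t ⬝ᵥ w t) (fun t => v' t ⬝ᵥ w t + v t ⬝ᵥ w' t) a b := by
  simp only [_root_.dotProduct, ← Finset.sum_add_distrib]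
  exact IsPrimitiveOn.sum _ fun i _ => (hv i).mul hab (hw i)

theorem IsPrimitiveOn.mulVec {k : ℕ} {M M' : ℝ → Matrix (Fin k) (Fin k) ℝ}
    {v v' : ℝ → Fin k → ℝ} {a b : ℝ} (hab : a ≤ b)
    (hM : ∀ i j, IsPrimitiveOn (fun t => M t i j) (fun t => M' t i j) a b)
    (hv : ∀ i, IsPrimitiveOn (fun t => v t i) (fun t => v' t i) a b) (i : Fin k) :
    IsPrimitiveOn (fun t => (M t *ᵥ v t) i) (fun t => (M' t *ᵥ v t + M t *ᵥ v' t) i) a b :=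
  IsPrimitiveOn.dotProduct hab (hM i) hv

/-! ### Products of bounded and integrable functions -/

section Bounded

variable {α : Type*} [MeasurableSpace α] {μ : Measure α}

/-- The Hölder triple is left free because several are needed: (∞, p, p) for a coefficient times a
state or control, (2, 2, 1) for the control energy. -/
theorem memLp_dotProduct {k : ℕ} {v w : α → Fin k → ℝ} {p q r : ENNReal} [ENNReal.HolderTriple p q r]
    (hv : ∀ i, MemLp (fun t => v t i) p μ) (hw : ∀ i, MemLp (fun t => w t i) q μ) :
    MemLp (fun t => v t ⬝ᵥ w t) r μ := by
  simp only [dotProduct]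
  exact memLp_finsetSum _ fun i _ => (hw i).mul (hv i)

theorem memLp_mulVec {k l : ℕ} {M : α → Matrix (Fin k) (Fin l) ℝ} {v : α → Fin l → ℝ}
    {p : ENNReal} (hM : ∀ i j, MemLp (fun t => M t i j) ⊤ μ)
    (hv : ∀ j, MemLp (fun t => v t j) p μ) (i : Fin k) :
    MemLp (fun t => (M t *ᵥ v t) i) p μ :=
  memLp_dotProduct (hM i) hv

theorem memLp_matrix_mul {k l r : ℕ} {M : α → Matrix (Fin k) (Fin l) ℝ}
    {N : α → Matrix (Fin l) (Fin r) ℝ} (hM : ∀ i j, MemLp (fun t => M t i j) ⊤ μ)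
    (hN : ∀ i j, MemLp (fun t => N t i j) ⊤ μ) (i : Fin k) (j : Fin r) :
    MemLp (fun t => (M t * N t) i j) ⊤ μ := by
  simp only [Matrix.mul_apply]
  exact memLp_finsetSum _ fun s _ => (hN s j).mul (hM i s)

theorem exists_ae_abs_le_of_memLp_top {f : α → ℝ} (hf : MemLp f ⊤ μ) :
    ∃ K : ℝ, ∀ᵐ t ∂μ, |f t| ≤ K := by
  refine ⟨(eLpNormEssSup f μ).toReal, ?_⟩
  have h : eLpNormEssSup f μ ≠ ⊤ := by
    have := hf.2.ne; rwa [eLpNorm_exponent_top] at this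
  filter_upwards [enorm_ae_le_eLpNormEssSup f μ] with t ht
  have := ENNReal.toReal_mono h ht
  simpa using this

end Bounded

theorem memLp_top_of_continuousOn {f : ℝ → ℝ} {a b : ℝ} (hf : ContinuousOn f (Icc a b)) :
    MemLp f ⊤ (volume.restrict (Ioc a b)) := by
  obtain ⟨K, hK⟩ := isCompact_Icc.exists_bound_of_continuousOn hf
  refine memLp_top_of_bound ((hf.mono Ioc_subset_Icc_self).aestronglyMeasurable measurableSet_Ioc)
    K ?_
  filter_upwards [ae_restrict_mem measurableSet_Ioc] with t ht
  exact hK t (Ioc_subset_Icc_self ht)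

theorem intervalIntegrable_of_memLp {f : ℝ → ℝ} {a b : ℝ} {p : ENNReal} (hp : 1 ≤ p) (hab : a ≤ b)
    (hf : MemLp f p (volume.restrict (Ioc a b))) : IntervalIntegrable f volume a b :=
  (intervalIntegrable_iff_integrableOn_Ioc_of_le hab).2 (hf.integrable hp)

/-! ### Linear equations with bounded coefficients -/

section LinearODE

variable {k : ℕ} {M : ℝ → Matrix (Fin k) (Fin k) ℝ} {f : ℝ → Fin k → ℝ} {a b : ℝ}

theorem intervalIntegrable_linear_rhs (hab : a ≤ b)
    (hM : ∀ i j, MemLp (fun t => M t i j) ⊤ (volume.restrict (Ioc a b)))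
    (hf : ∀ i, MemLp (fun t => f t i) 1 (volume.restrict (Ioc a b)))
    {ξ : ℝ → Fin k → ℝ} (hξ : ContinuousOn ξ (Icc a b)) :
    IntervalIntegrable (fun t => M t *ᵥ ξ t + f t) volume a b := by
  rw [intervalIntegrable_iff_integrableOn_Ioc_of_le hab]
  refine Integrable.of_eval fun i => ?_
  have h1 : MemLp (fun t => (M t *ᵥ ξ t) i) ⊤ (volume.restrict (Ioc a b)) :=
    memLp_mulVec hM (fun j => memLp_top_of_continuousOn (continuousOn_pi.1 hξ j)) i
  exact (h1.integrable le_top).add ((hf i).integrable le_rfl)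

theorem exists_lipschitz_linear_rhs (f : ℝ → Fin k → ℝ)
    (hM : ∀ i j, MemLp (fun t => M t i j) ⊤ (volume.restrict (Ioc a b))) :
    ∃ K : ℝ, 0 < K ∧ ∀ᵐ s, s ∈ Icc a b →
      ∀ x y : Fin k → ℝ, ‖(M s *ᵥ x + f s) - (M s *ᵥ y + f s)‖ ≤ K * ‖x - y‖ := by
  choose c hc using fun i j => exists_ae_abs_le_of_memLp_top (hM i j)
  -- In the sup norm each row sum bounds one component; the sum over all entries dominates every
  -- row, and the 1 keeps K positive even if M vanishes.
  refine ⟨∑ i, ∑ j, |c i j| + 1, by positivity, ?_⟩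
  have h : ∀ᵐ s ∂(volume.restrict (Icc a b)), ∀ i j, |M s i j| ≤ c i j := by
    rw [← restrict_Ioc_eq_restrict_Icc]
    exact ae_all_iff.2 fun i => ae_all_iff.2 fun j => hc i j
  rw [ae_restrict_iff' measurableSet_Icc] at h
  filter_upwards [h] with s hs hmem x y
  rw [add_sub_add_right_eq_sub, ← mulVec_sub]
  rw [pi_norm_le_iff_of_nonneg (by positivity)]
  intro i
  calc ‖(M s *ᵥ (x - y)) i‖ ≤ ∑ j, ‖M s i j * (x - y) j‖ := by
        simp only [mulVec, dotProduct]; exact norm_sum_le _ _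
    _ ≤ ∑ j, |c i j| * ‖x - y‖ := Finset.sum_le_sum fun j _ => by
        rw [norm_mul]
        exact mul_le_mul ((hs hmem i j).trans (le_abs_self _)) (norm_le_pi_norm _ j)
          (norm_nonneg _) (abs_nonneg _)
    _ = (∑ j, |c i j|) * ‖x - y‖ := by rw [Finset.sum_mul]
    _ ≤ _ := by
        refine mul_le_mul_of_nonneg_right ?_ (norm_nonneg _)
        have := Finset.single_le_sum (f := fun i => ∑ j, |c i j|)
          (fun i _ => Finset.sum_nonneg fun j _ => abs_nonneg _) (Finset.mem_univ i)
        linarith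

theorem exists_linear_initial (hab : a ≤ b)
    (hM : ∀ i j, MemLp (fun t => M t i j) ⊤ (volume.restrict (Ioc a b)))
    (hf : ∀ i, MemLp (fun t => f t i) 1 (volume.restrict (Ioc a b))) (x : Fin k → ℝ) :
    ∃ ξ : ℝ → Fin k → ℝ, Continuous ξ ∧ ξ a = x ∧
      ∀ t ∈ Icc a b, ξ t = ξ a + ∫ s in a..t, (M s *ᵥ ξ s + f s) := by
  obtain ⟨K, hK, hlip⟩ := exists_lipschitz_linear_rhs f hM
  obtain ⟨ξ, hξ, h⟩ := exists_integral_equation_of_lipschitz (F := fun s x => M s *ᵥ x + f s) hab hK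
    (fun g hg => intervalIntegrable_linear_rhs hab hM hf hg.continuousOn) hlip x
  have ha : ξ a = x := by simpa using h a (left_mem_Icc.2 hab)
  exact ⟨ξ, hξ, ha, ha ▸ h⟩

theorem exists_linear_final (hab : a ≤ b)
    (hM : ∀ i j, MemLp (fun t => M t i j) ⊤ (volume.restrict (Ioc a b)))
    (hf : ∀ i, MemLp (fun t => f t i) 1 (volume.restrict (Ioc a b))) (y : Fin k → ℝ) :
    ∃ ξ : ℝ → Fin k → ℝ, Continuous ξ ∧ ξ b = y ∧
      ∀ t ∈ Icc a b, ξ t = ξ a + ∫ s in a..t, (M s *ᵥ ξ s + f s) := by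
  obtain ⟨K, hK, hlip⟩ := exists_lipschitz_linear_rhs f hM
  exact exists_integral_equation_of_lipschitz_final (F := fun s x => M s *ᵥ x + f s) hab hK
    (fun g hg => intervalIntegrable_linear_rhs hab hM hf hg.continuousOn) hlip y

end LinearODE

theorem isPrimitiveOn_eval {k : ℕ} {ξ f : ℝ → Fin k → ℝ} {a b : ℝ}
    (hf : IntervalIntegrable f volume a b)
    (h : ∀ t ∈ Icc a b, ξ t = ξ a + ∫ s in a..t, f s) (i : Fin k) :
    IsPrimitiveOn (fun t => ξ t i) (fun t => f t i) a b := by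
  have hi : ∀ {t}, a ≤ t → t ≤ b → ∀ i, Integrable (fun s => f s i) (volume.restrict (Ioc a t)) := by
    intro t hat htb
    have h1 : IntervalIntegrable f volume a t := hf.mono_set (by
      rw [uIcc_of_le hat, uIcc_of_le (hat.trans htb)]; exact Icc_subset_Icc_right htb)
    exact ((intervalIntegrable_iff_integrableOn_Ioc_of_le hat).1 h1).eval
  constructor
  · exact ⟨hf.1.eval i, hf.2.eval i⟩
  · intro t ht
    have h1 := congrFun (h t ht) i
    rw [Pi.add_apply, intervalIntegral.integral_of_le ht.1, eval_integral (hi ht.1 ht.2)] at h1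
    rw [intervalIntegral.integral_of_le ht.1]
    exact h1

/-! ### Boundedness and measurability of the coefficients -/

namespace LQSystem

variable {n m : ℕ}

/-- The coefficients are measurable and essentially bounded on `(a, b]`. -/
structure IsBoundedOn (D : LQSystem n m) (a b : ℝ) : Prop where
  A : ∀ i j, MemLp (fun t => D.A t i j) ⊤ (volume.restrict (Ioc a b))
  C : ∀ i j, MemLp (fun t => D.C t i j) ⊤ (volume.restrict (Ioc a b))
  σ : ∀ i j, MemLp (fun t => D.σ t i j) ⊤ (volume.restrict (Ioc a b))

theorem IsBoundedOn.mono {D : LQSystem n m} {a b a' b' : ℝ} (h : D.IsBoundedOn a b)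
    (ha : a ≤ a') (hb : b' ≤ b) : D.IsBoundedOn a' b' where
  A i j := (h.A i j).mono_measure (Measure.restrict_mono_set _ (Ioc_subset_Ioc ha hb))
  C i j := (h.C i j).mono_measure (Measure.restrict_mono_set _ (Ioc_subset_Ioc ha hb))
  σ i j := (h.σ i j).mono_measure (Measure.restrict_mono_set _ (Ioc_subset_Ioc ha hb))

theorem IsBoundedOn.Sig {D : LQSystem n m} {a b : ℝ} (h : D.IsBoundedOn a b) (i j : Fin n) :
    MemLp (fun t => D.Sig t i j) ⊤ (volume.restrict (Ioc a b)) :=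
  memLp_matrix_mul h.σ (fun i j => h.σ j i) i j

end LQSystem

/-- Away from the finitely many discontinuities, a null set, F is continuous and so measurable. -/
theorem PiecewiseContinuousOn.memLp_top {n : ℕ} {F : ℝ → Matrix (Fin n) (Fin n) ℝ}
    {Tbar : EReal} {T a : ℝ} (hpc : PiecewiseContinuousOn F Tbar T)
    (hb : LocallyBoundedOn F Tbar T) (ha : Tbar < (a : EReal)) (i j : Fin n) :
    MemLp (fun t => F t i j) ⊤ (volume.restrict (Ioc a T)) := by
  obtain ⟨K, hK⟩ := hb a ha
  set N := {t ∈ Icc a T | ¬ ContinuousWithinAt F (Icc a T) t} with hN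
  have hfin : N.Finite := hpc a ha
  have hcont : ContinuousOn F (Icc a T \ N) := fun t ht => by
    have : ContinuousWithinAt F (Icc a T) t := by
      by_contra h; exact ht.2 ⟨ht.1, h⟩
    exact this.mono sdiff_subset
  have hmeas : AEStronglyMeasurable (fun t => F t i j) (volume.restrict (Icc a T \ N)) :=
    (continuousOn_pi.1 (continuousOn_pi.1 hcont i) j).aestronglyMeasurable
      (measurableSet_Icc.diff hfin.measurableSet)
  have hae : (Icc a T \ N : Set ℝ) =ᵐ[volume] Ioc a T :=
    (sdiff_null_ae_eq_self (hfin.measure_zero volume)).trans Ioc_ae_eq_Icc.symm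
  rw [Measure.restrict_congr_set hae] at hmeas
  refine memLp_top_of_bound hmeas K ?_
  filter_upwards [ae_restrict_mem measurableSet_Ioc] with t ht
  exact hK t (Ioc_subset_Icc_self ht) i j

/-- For σ the bound comes from the diagonal of Σ: Σ_ii is the sum of the squares of row i of σ, so
Σ_ii ≤ K forces |σ_ij| ≤ √K. -/
theorem LQSystem.StandingAssumptions.isBoundedOn {n m : ℕ} {D : LQSystem n m} {Tbar : EReal}
    {T : ℝ} (hD : D.StandingAssumptions Tbar T) {a : ℝ} (ha : Tbar < (a : EReal)) :
    D.IsBoundedOn a T where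
  A := hD.A_pc.memLp_top hD.A_bdd ha
  C := hD.C_pc.memLp_top hD.C_bdd ha
  σ i j := by
    obtain ⟨K, hK⟩ := hD.Sig_bdd a ha
    have hsub : Ioc a T ⊆ timeInterval Tbar T := fun t ht =>
      ⟨ha.trans (EReal.coe_lt_coe_iff.2 ht.1), ht.2⟩
    refine memLp_top_of_bound ((hD.σ_meas i j).mono_measure
      (Measure.restrict_mono_set _ hsub)).aestronglyMeasurable (Real.sqrt K) ?_
    filter_upwards [ae_restrict_mem measurableSet_Ioc] with t ht
    refine Real.abs_le_sqrt ?_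
    have h1 : D.Sig t i i = ∑ j, D.σ t i j ^ 2 := by
      simp only [LQSystem.Sig, Matrix.mul_apply, transpose_apply, sq]
    calc D.σ t i j ^ 2 ≤ ∑ j, D.σ t i j ^ 2 :=
          Finset.single_le_sum (f := fun j => D.σ t i j ^ 2) (fun _ _ => sq_nonneg _)
            (Finset.mem_univ j)
      _ = D.Sig t i i := h1.symm
      _ ≤ K := (le_abs_self _).trans (hK t (Ioc_subset_Icc_self ht) i i)

/-! ### Quadratic solutions of the Hamilton-Jacobi-Bellman equation -/

namespace LQSystem

variable {n m : ℕ}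

/-- `p`, `g`, `c` solve on `[a, b]` the equations for which
`½ x' p(t) x + x' g(t) + c(t)` solves the Hamilton-Jacobi-Bellman equation. -/
structure IsQuadraticSolution (D : LQSystem n m) (p : ℝ → Matrix (Fin n) (Fin n) ℝ)
    (g : ℝ → Fin n → ℝ) (c : ℝ → ℝ) (a b : ℝ) : Prop where
  symm : ∀ t ∈ Icc a b, (p t).IsSymm
  p_prim : ∀ i j, IsPrimitiveOn (fun t => p t i j) (fun t =>
    (-((D.A t)ᵀ * p t + p t * D.A t + D.C t + p t * D.Sig t * p t)) i j) a b
  g_prim : ∀ i, IsPrimitiveOn (fun t => g t i) (fun t => (-((D.A t + D.Sig t * p t)ᵀ *ᵥ g t)) i) a b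
  c_prim : IsPrimitiveOn c (fun t => -(1 / 2 * (g t ⬝ᵥ (D.Sig t *ᵥ g t)))) a b

theorem IsQuadraticSolution.mono {D : LQSystem n m} {p : ℝ → Matrix (Fin n) (Fin n) ℝ}
    {g : ℝ → Fin n → ℝ} {c : ℝ → ℝ} {a b a' b' : ℝ} (h : D.IsQuadraticSolution p g c a b)
    (ha : a ≤ a') (hab : a' ≤ b') (hb : b' ≤ b) : D.IsQuadraticSolution p g c a' b' where
  symm t ht := h.symm t ⟨ha.trans ht.1, ht.2.trans hb⟩
  p_prim i j := (h.p_prim i j).mono ha hab hb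
  g_prim i := (h.g_prim i).mono ha hab hb
  c_prim := h.c_prim.mono ha hab hb

end LQSystem

/-- The quadratic function `½ x' p(t) x + x' g(t) + c(t)`. -/
noncomputable def quadraticValue {n : ℕ} (p : ℝ → Matrix (Fin n) (Fin n) ℝ) (g : ℝ → Fin n → ℝ) (c : ℝ → ℝ)
    (t : ℝ) (x : Fin n → ℝ) : ℝ :=
  1 / 2 * (x ⬝ᵥ (p t *ᵥ x)) + x ⬝ᵥ g t + c t

theorem mul_transpose_quadratic {n m : ℕ} (σ : Matrix (Fin n) (Fin m) ℝ) (v w : Fin n → ℝ) :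
    v ⬝ᵥ ((σ * σᵀ) *ᵥ w) = (σᵀ *ᵥ v) ⬝ᵥ (σᵀ *ᵥ w) := by
  rw [← mulVec_mulVec, dotProduct_mulVec, ← mulVec_transpose]

/-- The left side is what the product rule yields for the derivative of ½ x'px + x'g + c when x' =
Ax + σu. By symmetry of p the terms in A cancel against the Riccati and adjoint equations, and what
remains besides -l completes to a square in u. -/
theorem riccati_completion_of_squares {n m : ℕ} (A C p : Matrix (Fin n) (Fin n) ℝ)
    (σ : Matrix (Fin n) (Fin m) ℝ) (hp : p.IsSymm) (x g : Fin n → ℝ) (u : Fin m → ℝ) :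
    1 / 2 * ((A *ᵥ x + σ *ᵥ u) ⬝ᵥ (p *ᵥ x) + x ⬝ᵥ
        (-(Aᵀ * p + p * A + C + p * (σ * σᵀ) * p) *ᵥ x + p *ᵥ (A *ᵥ x + σ *ᵥ u))) +
      ((A *ᵥ x + σ *ᵥ u) ⬝ᵥ g + x ⬝ᵥ (-((A + σ * σᵀ * p)ᵀ *ᵥ g))) +
      -(1 / 2 * (g ⬝ᵥ ((σ * σᵀ) *ᵥ g))) =
    -(1 / 2 * (x ⬝ᵥ (C *ᵥ x)) - 1 / 2 * (u ⬝ᵥ u)) -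
      1 / 2 * ((u - σᵀ *ᵥ (p *ᵥ x + g)) ⬝ᵥ (u - σᵀ *ᵥ (p *ᵥ x + g))) := by
  have hpx : ∀ v w : Fin n → ℝ, v ⬝ᵥ (p *ᵥ w) = (p *ᵥ v) ⬝ᵥ w := fun v w => by
    rw [dotProduct_mulVec, ← mulVec_transpose, hp.eq]
  have hA : ∀ v w : Fin n → ℝ, v ⬝ᵥ (Aᵀ *ᵥ w) = (A *ᵥ v) ⬝ᵥ w := fun v w => by
    rw [dotProduct_mulVec, vecMul_transpose]
  have hσ : ∀ w : Fin n → ℝ, (σ *ᵥ u) ⬝ᵥ w = u ⬝ᵥ (σᵀ *ᵥ w) := fun w => by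
    rw [dotProduct_mulVec, vecMul_transpose]
  have hT : ∀ v w : Fin n → ℝ, v ⬝ᵥ ((A + σ * σᵀ * p)ᵀ *ᵥ w) =
      (A *ᵥ v) ⬝ᵥ w + (σᵀ *ᵥ (p *ᵥ v)) ⬝ᵥ (σᵀ *ᵥ w) := fun v w => by
    rw [dotProduct_mulVec, vecMul_transpose, add_mulVec, add_dotProduct, ← mulVec_mulVec,
      dotProduct_comm ((σ * σᵀ) *ᵥ _), mul_transpose_quadratic, dotProduct_comm (σᵀ *ᵥ w)]
  have hR : x ⬝ᵥ ((Aᵀ * p + p * A + C + p * (σ * σᵀ) * p) *ᵥ x) =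
      2 * ((A *ᵥ x) ⬝ᵥ (p *ᵥ x)) + x ⬝ᵥ (C *ᵥ x) +
        (σᵀ *ᵥ (p *ᵥ x)) ⬝ᵥ (σᵀ *ᵥ (p *ᵥ x)) := by
    rw [add_mulVec, add_mulVec, add_mulVec, dotProduct_add, dotProduct_add, dotProduct_add,
      ← mulVec_mulVec, hA, ← mulVec_mulVec, hpx x, dotProduct_comm (p *ᵥ x), Matrix.mul_assoc,
      ← mulVec_mulVec, hpx x, ← mulVec_mulVec, mul_transpose_quadratic]
    ring
  rw [neg_mulVec, dotProduct_neg, dotProduct_add, dotProduct_neg, hT, hR, hpx x,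
    mul_transpose_quadratic, dotProduct_comm (p *ᵥ x), mulVec_add σᵀ]
  simp only [add_dotProduct, dotProduct_add, sub_dotProduct, dotProduct_sub, hσ]
  rw [dotProduct_comm (σᵀ *ᵥ (p *ᵥ x)) u, dotProduct_comm (σᵀ *ᵥ g) u,
    dotProduct_comm (σᵀ *ᵥ g) (σᵀ *ᵥ (p *ᵥ x))]
  ring

/-! ### Verification along trajectories and optimal feedback -/

namespace LQSystem

variable {n m : ℕ} {D : LQSystem n m} {p : ℝ → Matrix (Fin n) (Fin n) ℝ}
  {g : ℝ → Fin n → ℝ} {c : ℝ → ℝ} {a b : ℝ}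

theorem IsTrajectory.isPrimitiveOn {u : ℝ → Fin m → ℝ} {ξ : ℝ → Fin n → ℝ} (hab : a ≤ b)
    (hD : D.IsBoundedOn a b) (h : D.IsTrajectory a b u ξ) (i : Fin n) :
    IsPrimitiveOn (fun t => ξ t i) (fun t => (D.A t *ᵥ ξ t + D.σ t *ᵥ u t) i) a b := by
  have hσu : ∀ i, MemLp (fun t => (D.σ t *ᵥ u t) i) 1 (volume.restrict (Ioc a b)) := fun i =>
    (memLp_mulVec hD.σ h.1.eval i).mono_exponent one_le_two
  exact isPrimitiveOn_eval (intervalIntegrable_linear_rhs hab hD.A hσu h.2.1) h.2.2 i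

theorem IsQuadraticSolution.memLp_p (hq : D.IsQuadraticSolution p g c a b) (i j : Fin n) :
    MemLp (fun t => p t i j) ⊤ (volume.restrict (Ioc a b)) :=
  memLp_top_of_continuousOn (hq.p_prim i j).continuousOn

theorem IsQuadraticSolution.memLp_g (hq : D.IsQuadraticSolution p g c a b) (i : Fin n) :
    MemLp (fun t => g t i) ⊤ (volume.restrict (Ioc a b)) :=
  memLp_top_of_continuousOn (hq.g_prim i).continuousOn

theorem IsQuadraticSolution.memLp_feedback (hq : D.IsQuadraticSolution p g c a b)
    (hD : D.IsBoundedOn a b) {ξ : ℝ → Fin n → ℝ} (hξ : ContinuousOn ξ (Icc a b)) (i : Fin m) :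
    MemLp (fun t => ((D.σ t)ᵀ *ᵥ (p t *ᵥ ξ t + g t)) i) ⊤ (volume.restrict (Ioc a b)) := by
  refine memLp_mulVec (fun i j => hD.σ j i) (fun j => ?_) i
  exact (memLp_mulVec hq.memLp_p
    (fun i => memLp_top_of_continuousOn (continuousOn_pi.1 hξ i)) j).add (hq.memLp_g j)

/-- Along a trajectory, the payoff falls short of the decrease of the quadratic solution of the
Hamilton-Jacobi-Bellman equation by the squared distance of the control from the feedback. -/
theorem IsQuadraticSolution.runningPayoff_add (hab : a ≤ b)
    (hq : D.IsQuadraticSolution p g c a b) (hD : D.IsBoundedOn a b) {u : ℝ → Fin m → ℝ}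
    {ξ : ℝ → Fin n → ℝ} (h : D.IsTrajectory a b u ξ) :
    D.runningPayoff a b u ξ + quadraticValue p g c b (ξ b) = quadraticValue p g c a (ξ a) -
      1 / 2 * ∫ t in a..b, (u t - (D.σ t)ᵀ *ᵥ (p t *ᵥ ξ t + g t)) ⬝ᵥ
        (u t - (D.σ t)ᵀ *ᵥ (p t *ᵥ ξ t + g t)) := by
  set v : ℝ → Fin m → ℝ := fun t => u t - (D.σ t)ᵀ *ᵥ (p t *ᵥ ξ t + g t)
  have hξ := h.isPrimitiveOn hab hD
  have hprim := (((IsPrimitiveOn.dotProduct hab hξ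
    (IsPrimitiveOn.mulVec hab hq.p_prim hξ)).const_mul (1 / 2)).add
    (IsPrimitiveOn.dotProduct hab hξ hq.g_prim)).add hq.c_prim
  have hv2 : ∀ i, MemLp (fun t => v t i) 2 (volume.restrict (Ioc a b)) := fun i =>
    (h.1.eval i).sub ((hq.memLp_feedback hD h.2.1 i).mono_exponent le_top)
  have hvv : IntervalIntegrable (fun t => v t ⬝ᵥ v t) volume a b :=
    intervalIntegrable_of_memLp le_rfl hab (memLp_dotProduct hv2 hv2)
  have huu : IntervalIntegrable (fun t => u t ⬝ᵥ u t) volume a b :=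
    intervalIntegrable_of_memLp le_rfl hab (memLp_dotProduct h.1.eval h.1.eval)
  have hξ' : ∀ i, MemLp (fun t => ξ t i) ⊤ (volume.restrict (Ioc a b)) := fun i =>
    memLp_top_of_continuousOn (continuousOn_pi.1 h.2.1 i)
  have hCC : IntervalIntegrable (fun t => ξ t ⬝ᵥ (D.C t *ᵥ ξ t)) volume a b :=
    intervalIntegrable_of_memLp le_top hab (memLp_dotProduct (r := ⊤) hξ' (memLp_mulVec hD.C hξ'))
  have hl : IntervalIntegrable (fun t => D.l t (ξ t) (u t)) volume a b :=
    (hCC.const_mul (1 / 2)).sub (huu.const_mul (1 / 2))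
  have hint : ∫ t in a..b, (-D.l t (ξ t) (u t) - 1 / 2 * (v t ⬝ᵥ v t)) =
      -D.runningPayoff a b u ξ - 1 / 2 * ∫ t in a..b, v t ⬝ᵥ v t := by
    rw [intervalIntegral.integral_sub (f := fun t => -D.l t (ξ t) (u t)) hl.neg
      (hvv.const_mul _), intervalIntegral.integral_neg,
      intervalIntegral.integral_const_mul, runningPayoff]
  have key := (hprim.sub_eq (left_mem_Icc.2 hab) (right_mem_Icc.2 hab)).trans <|
    (intervalIntegral.integral_congr fun t ht =>
      riccati_completion_of_squares (D.A t) (D.C t) (p t) (D.σ t)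
        (hq.symm t (uIcc_of_le hab ▸ ht)) (ξ t) (g t) (u t)).trans hint
  simp only [quadraticValue]
  linarith

theorem IsQuadraticSolution.runningPayoff_add_le (hab : a ≤ b)
    (hq : D.IsQuadraticSolution p g c a b) (hD : D.IsBoundedOn a b) {u : ℝ → Fin m → ℝ}
    {ξ : ℝ → Fin n → ℝ} (h : D.IsTrajectory a b u ξ) :
    D.runningPayoff a b u ξ + quadraticValue p g c b (ξ b) ≤ quadraticValue p g c a (ξ a) := by
  rw [hq.runningPayoff_add hab hD h]
  have : 0 ≤ ∫ t in a..b, (u t - (D.σ t)ᵀ *ᵥ (p t *ᵥ ξ t + g t)) ⬝ᵥ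
        (u t - (D.σ t)ᵀ *ᵥ (p t *ᵥ ξ t + g t)) :=
    intervalIntegral.integral_nonneg hab fun t _ => Finset.sum_nonneg fun i _ => mul_self_nonneg _
  linarith

theorem IsQuadraticSolution.memLp_closedLoop (hq : D.IsQuadraticSolution p g c a b)
    (hD : D.IsBoundedOn a b) (i j : Fin n) :
    MemLp (fun t => (D.A t + D.Sig t * p t) i j) ⊤ (volume.restrict (Ioc a b)) :=
  (hD.A i j).add (memLp_matrix_mul hD.Sig hq.memLp_p i j)

/-- Since σσ'(pξ + g) = Σpξ + Σg, a closed-loop solution is a trajectory under the feedback control,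
for which the square vanishes. -/
theorem IsQuadraticSolution.feedback_isOptimal (hab : a ≤ b)
    (hq : D.IsQuadraticSolution p g c a b) (hD : D.IsBoundedOn a b) {ξ : ℝ → Fin n → ℝ}
    (hξ : Continuous ξ) (h : ∀ t ∈ Icc a b, ξ t = ξ a + ∫ s in a..t,
      ((D.A s + D.Sig s * p s) *ᵥ ξ s + D.Sig s *ᵥ g s)) :
    ∃ u, D.IsTrajectory a b u ξ ∧
      D.runningPayoff a b u ξ + quadraticValue p g c b (ξ b) = quadraticValue p g c a (ξ a) := by
  have htraj : D.IsTrajectory a b (fun t => (D.σ t)ᵀ *ᵥ (p t *ᵥ ξ t + g t)) ξ := by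
    refine ⟨MemLp.of_eval fun i => (hq.memLp_feedback hD hξ.continuousOn i).mono_exponent le_top,
      hξ.continuousOn, fun t ht => ?_⟩
    rw [h t ht]
    congr 2
    ext1 s
    rw [mulVec_mulVec, add_mulVec, mulVec_add, ← mulVec_mulVec, add_assoc]
    rfl
  refine ⟨_, htraj, ?_⟩
  rw [hq.runningPayoff_add hab hD htraj]
  simp

theorem IsQuadraticSolution.exists_optimal_initial (hab : a ≤ b)
    (hq : D.IsQuadraticSolution p g c a b) (hD : D.IsBoundedOn a b) (x : Fin n → ℝ) :
    ∃ u ξ, D.IsTrajectory a b u ξ ∧ ξ a = x ∧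
      D.runningPayoff a b u ξ + quadraticValue p g c b (ξ b) = quadraticValue p g c a x := by
  obtain ⟨ξ, hξ, hx, h⟩ := exists_linear_initial hab (hq.memLp_closedLoop hD)
    (fun i => (memLp_mulVec hD.Sig hq.memLp_g i).mono_exponent le_top) x
  obtain ⟨u, hu, he⟩ := hq.feedback_isOptimal hab hD hξ h
  exact ⟨u, ξ, hu, hx, hx ▸ he⟩

/-- The closed-loop equation is solved backward from y. The same feedback is therefore optimal for
the backward problem, whose initial point is left free. -/
theorem IsQuadraticSolution.exists_optimal_final (hab : a ≤ b)
    (hq : D.IsQuadraticSolution p g c a b) (hD : D.IsBoundedOn a b) (y : Fin n → ℝ) :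
    ∃ u ξ, D.IsTrajectory a b u ξ ∧ ξ b = y ∧
      D.runningPayoff a b u ξ + quadraticValue p g c b y = quadraticValue p g c a (ξ a) := by
  obtain ⟨ξ, hξ, hy, h⟩ := exists_linear_final hab (hq.memLp_closedLoop hD)
    (fun i => (memLp_mulVec hD.Sig hq.memLp_g i).mono_exponent le_top) y
  obtain ⟨u, hu, he⟩ := hq.feedback_isOptimal hab hD hξ h
  exact ⟨u, ξ, hu, hy, hy ▸ he⟩

/-! ### Action of the operators on quadratic functions -/

theorem IsQuadraticSolution.forwardOp_eq (hab : a ≤ b)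
    (hq : D.IsQuadraticSolution p g c a b) (hD : D.IsBoundedOn a b) :
    D.forwardOp a b (fun x => (quadraticValue p g c b x : EReal)) =
      fun x => (quadraticValue p g c a x : EReal) := by
  funext x
  apply le_antisymm
  · refine iSup_le fun u => iSup_le fun ξ => iSup_le fun h => iSup_le fun hx => ?_
    rw [← EReal.coe_add, EReal.coe_le_coe_iff, ← hx]
    exact hq.runningPayoff_add_le hab hD h
  · obtain ⟨u, ξ, h, hx, he⟩ := hq.exists_optimal_initial hab hD x
    rw [← he, EReal.coe_add]
    exact le_iSup_of_le u (le_iSup_of_le ξ (le_iSup_of_le h (le_iSup_of_le hx le_rfl)))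

/-- `runningPayoff_add_le`, solved for the final term, bounds every competitor from below; the
closed-loop trajectory ending at y attains the bound. -/
theorem IsQuadraticSolution.backwardOp_eq (hab : a ≤ b)
    (hq : D.IsQuadraticSolution p g c a b) (hD : D.IsBoundedOn a b) :
    D.backwardOp b a (fun x => (quadraticValue p g c a x : EReal)) =
      fun x => (quadraticValue p g c b x : EReal) := by
  funext y
  apply le_antisymm
  · obtain ⟨u, ξ, h, hy, he⟩ := hq.exists_optimal_final hab hD y
    rw [eq_neg_add_of_add_eq he, EReal.coe_add]
    exact iInf_le_of_le u (iInf_le_of_le ξ (iInf_le_of_le h (iInf_le_of_le hy le_rfl)))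
  · refine le_iInf fun u => le_iInf fun ξ => le_iInf fun h => le_iInf fun hy => ?_
    rw [← EReal.coe_add, EReal.coe_le_coe_iff, ← hy]
    linarith [hq.runningPayoff_add_le hab hD h]

theorem value_eq_forwardOp (D : LQSystem n m) (T : ℝ) (P S Q : Matrix (Fin n) (Fin n) ℝ)
    (z : Fin n → ℝ) (t : ℝ) :
    D.value T P S Q z t = D.forwardOp t T (fun x => (terminalPayoff P S Q z x : EReal)) := by
  funext x
  simp only [value, forwardOp, EReal.coe_add]

/-- Adjoint linear equation and quadrature complete a Riccati solution. -/
theorem IsRiccatiSolution.exists_isQuadraticSolution {Tbar : EReal} {T : ℝ}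
    {P : Matrix (Fin n) (Fin n) ℝ} (hp : D.IsRiccatiSolution Tbar T P p)
    (ha : Tbar < (a : EReal)) (haT : a ≤ T) (hD : D.IsBoundedOn a T)
    (S Q : Matrix (Fin n) (Fin n) ℝ) (z : Fin n → ℝ) :
    ∃ g c, D.IsQuadraticSolution p g c a T ∧
      quadraticValue p g c T = terminalPayoff P S Q z := by
  have hmem : ∀ t ∈ Icc a T, t ∈ timeInterval Tbar T := fun t ht =>
    ⟨ha.trans_le (EReal.coe_le_coe_iff.2 ht.1), ht.2⟩
  have hpc : ∀ i j, ContinuousOn (fun t => p t i j) (Icc a T) := fun i j =>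
    continuousOn_pi.1 (continuousOn_pi.1 (hp.1.mono hmem) i) j
  have hpL : ∀ i j, MemLp (fun t => p t i j) ⊤ (volume.restrict (Ioc a T)) := fun i j =>
    memLp_top_of_continuousOn (hpc i j)
  have hR : ∀ i j, IntervalIntegrable (fun t => ((D.A t)ᵀ * p t + p t * D.A t + D.C t +
      p t * D.Sig t * p t) i j) volume a T := fun i j =>
    intervalIntegrable_of_memLp le_top haT <|
      (((memLp_matrix_mul (fun i j => hD.A j i) hpL i j).add
        (memLp_matrix_mul hpL hD.A i j)).add (hD.C i j)).add
        (memLp_matrix_mul (memLp_matrix_mul hpL hD.Sig) hpL i j)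
  have hPT : p T = P := by
    ext i j
    simpa using hp.2.2 T (hmem T (right_mem_Icc.2 haT)) i j
  have hp_prim : ∀ i j, IsPrimitiveOn (fun t => p t i j) (fun t =>
      (-((D.A t)ᵀ * p t + p t * D.A t + D.C t + p t * D.Sig t * p t)) i j) a T := by
    intro i j
    refine ⟨(hR i j).neg, fun t ht => ?_⟩
    have h1 := hp.2.2 t (hmem t ht) i j
    have h2 := hp.2.2 a (hmem a (left_mem_Icc.2 haT)) i j
    rw [← intervalIntegral.integral_add_adjacent_intervals
      ((hR i j).mono_set (by rw [uIcc_of_le ht.1, uIcc_of_le haT]; exact Icc_subset_Icc_right ht.2))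
      ((hR i j).mono_set (by rw [uIcc_of_le ht.2, uIcc_of_le haT]; exact Icc_subset_Icc_left ht.1))]
      at h2
    simp only [Matrix.neg_apply, intervalIntegral.integral_neg]
    linarith
  have hM : ∀ i j, MemLp (fun t => (-(D.A t + D.Sig t * p t)ᵀ) i j) ⊤
      (volume.restrict (Ioc a T)) := fun i j =>
    ((hD.A j i).add (memLp_matrix_mul hD.Sig hpL j i)).neg
  have h0 : ∀ i, MemLp (fun _ : ℝ => (0 : Fin n → ℝ) i) 1 (volume.restrict (Ioc a T)) := fun i =>
    MemLp.zero
  -- The final value S z matches the linear term of φ^z.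
  obtain ⟨g, hg, hgT, hge⟩ := exists_linear_final haT hM h0 (S *ᵥ z)
  have hg_prim := isPrimitiveOn_eval (intervalIntegrable_linear_rhs haT hM h0 hg.continuousOn) hge
  simp only [add_zero, neg_mulVec] at hg_prim
  have hgL : ∀ i, MemLp (fun t => g t i) ⊤ (volume.restrict (Ioc a T)) := fun i =>
    memLp_top_of_continuousOn (continuousOn_pi.1 hg.continuousOn i)
  have hcI : IntervalIntegrable (fun t => -(1 / 2 * (g t ⬝ᵥ (D.Sig t *ᵥ g t)))) volume a T :=
    ((intervalIntegrable_of_memLp le_top haT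
      (memLp_dotProduct (r := ⊤) hgL (memLp_mulVec hD.Sig hgL))).const_mul (1 / 2)).neg
  -- Subtracting κ, the full integral, makes the constant term equal ½ z'Qz at time T.
  let κ := ∫ s in a..T, -(1 / 2 * (g s ⬝ᵥ (D.Sig s *ᵥ g s)))
  refine ⟨g, fun t => 1 / 2 * (z ⬝ᵥ (Q *ᵥ z)) - κ +
    ∫ s in a..t, -(1 / 2 * (g s ⬝ᵥ (D.Sig s *ᵥ g s))),
    ⟨fun t ht => hp.2.1 t (hmem t ht), hp_prim, hg_prim, hcI, by simp⟩, ?_⟩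
  funext x
  simp only [quadraticValue, terminalPayoff, hPT, hgT, κ]
  ring

end LQSystem

/-! ### The backward dynamic programming principle -/

theorem mainTheorem9 {n m : ℕ} (D : LQSystem n m) (Tbar : EReal) (T : ℝ)
    (hD : D.StandingAssumptions Tbar T) (t₁ t₂ : ℝ)
    (ht₁ : Tbar < (t₁ : EReal)) (ht : t₁ < t₂) (ht₂ : t₂ ≤ T) :
    (∀ P S Q : Matrix (Fin n) (Fin n) ℝ, D.IsTerminalData Tbar T P S Q →
      ∀ z : Fin n → ℝ,
        -- all the quantities involved are finite
        (∀ x, ∃ r : ℝ, D.value T P S Q z t₁ x = r) ∧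
        (∀ y, ∃ r : ℝ, D.value T P S Q z t₂ y = r) ∧
        (∀ x y, ∃ r : ℝ, D.kernel t₁ t₂ x y = r) ∧
        -- the backward dynamic programming principle, along backward trajectories
        (∀ y, D.value T P S Q z t₂ y =
          ⨅ (u : ℝ → Fin m → ℝ) (ξ : ℝ → Fin n → ℝ) (_ : D.IsTrajectory t₁ t₂ u ξ)
            (_ : ξ t₂ = y),
            ((-(∫ t in t₁..t₂, D.l t (ξ t) (u t)) : ℝ) : EReal) +
              D.value T P S Q z t₁ (ξ t₁)) ∧
        -- its form in terms of the max-plus kernel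
        (∀ y, D.value T P S Q z t₂ y =
          ⨅ x : Fin n → ℝ, (D.value T P S Q z t₁ x - D.kernel t₁ t₂ x y)) ∧
        -- the same with the backward and forward operators
        D.value T P S Q z t₂ = D.backwardOp t₂ t₁ (D.value T P S Q z t₁) ∧
        D.value T P S Q z t₂ =
          D.backwardOp t₂ t₁ (D.forwardOp t₁ t₂ (D.value T P S Q z t₂))) ∧
    -- on value functions, the backward and forward operators are inverse to each other
    MapsTo (D.forwardOp t₁ t₂) (D.valueFunctions Tbar T t₂) (D.valueFunctions Tbar T t₁) ∧
    MapsTo (D.backwardOp t₂ t₁) (D.valueFunctions Tbar T t₁) (D.valueFunctions Tbar T t₂) ∧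
    InvOn (D.backwardOp t₂ t₁) (D.forwardOp t₁ t₂)
      (D.valueFunctions Tbar T t₂) (D.valueFunctions Tbar T t₁) := by
  have hB := hD.isBoundedOn ht₁
  have hB12 := hB.mono le_rfl ht₂
  -- One triple (p, g, c), built on [t₁, T], represents the value function at both times.
  have main : ∀ P S Q : Matrix (Fin n) (Fin n) ℝ, D.IsTerminalData Tbar T P S Q →
      ∀ z : Fin n → ℝ, ∃ p g c, D.IsQuadraticSolution p g c t₁ t₂ ∧
        D.value T P S Q z t₁ = (fun x => (quadraticValue p g c t₁ x : EReal)) ∧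
        D.value T P S Q z t₂ = (fun x => (quadraticValue p g c t₂ x : EReal)) := by
    rintro P S Q ⟨-, -, -, p, hp⟩ z
    obtain ⟨g, c, hq, hT⟩ :=
      hp.exists_isQuadraticSolution ht₁ (ht.le.trans ht₂) hB S Q z
    refine ⟨p, g, c, hq.mono le_rfl ht.le ht₂, ?_, ?_⟩
    · rw [LQSystem.value_eq_forwardOp, ← hT]
      exact hq.forwardOp_eq (ht.le.trans ht₂) hB
    · rw [LQSystem.value_eq_forwardOp, ← hT]
      exact (hq.mono ht.le ht₂ le_rfl).forwardOp_eq ht₂ (hB.mono ht.le le_rfl)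
  have hfwd : ∀ P S Q : Matrix (Fin n) (Fin n) ℝ, D.IsTerminalData Tbar T P S Q →
      ∀ z : Fin n → ℝ, D.forwardOp t₁ t₂ (D.value T P S Q z t₂) = D.value T P S Q z t₁ := by
    intro P S Q h z
    obtain ⟨p, g, c, hq, h1, h2⟩ := main P S Q h z
    rw [h1, h2, hq.forwardOp_eq ht.le hB12]
  have hbwd : ∀ P S Q : Matrix (Fin n) (Fin n) ℝ, D.IsTerminalData Tbar T P S Q →
      ∀ z : Fin n → ℝ, D.backwardOp t₂ t₁ (D.value T P S Q z t₁) = D.value T P S Q z t₂ := by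
    intro P S Q h z
    obtain ⟨p, g, c, hq, h1, h2⟩ := main P S Q h z
    rw [h1, h2, hq.backwardOp_eq ht.le hB12]
  refine ⟨fun P S Q h z => ?_, ?_, ?_, ?_, ?_⟩
  · obtain ⟨p, g, c, hq, h1, h2⟩ := main P S Q h z
    have hker : ∀ x y, D.kernel t₁ t₂ x y ≤
        ((quadraticValue p g c t₁ x - quadraticValue p g c t₂ y : ℝ) : EReal) := by
      intro x y
      refine iSup_le fun u => iSup_le fun ξ => iSup_le fun hu => iSup_le fun hx => iSup_le fun hy => ?_
      rw [EReal.coe_le_coe_iff, ← hx, ← hy]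
      linarith [hq.runningPayoff_add_le ht.le hB12 hu]
    have hle : ∀ u ξ, D.IsTrajectory t₁ t₂ u ξ →
        ((D.runningPayoff t₁ t₂ u ξ : ℝ) : EReal) ≤ D.kernel t₁ t₂ (ξ t₁) (ξ t₂) := fun u ξ hu =>
      le_iSup_of_le u (le_iSup_of_le ξ (le_iSup_of_le hu (le_iSup_of_le rfl
        (le_iSup_of_le rfl le_rfl))))
    -- Controllability supplies a competitor, so the kernel is not -∞; `hker` bounds it above.
    have hfin : ∀ x y, ∃ r : ℝ, D.kernel t₁ t₂ x y = r := by
      intro x y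
      obtain ⟨u, ξ, hu, rfl, rfl⟩ := hD.controllable t₁ t₂ ht₁ ht ht₂ x y
      refine ⟨(D.kernel t₁ t₂ (ξ t₁) (ξ t₂)).toReal, (EReal.coe_toReal ?_ ?_).symm⟩
      · exact ne_top_of_le_ne_top (EReal.coe_ne_top _) (hker _ _)
      · exact ne_bot_of_le_ne_bot (EReal.coe_ne_bot _) (hle u ξ hu)
    refine ⟨fun x => ⟨_, congrFun h1 x⟩, fun y => ⟨_, congrFun h2 y⟩, hfin,
      fun y => (congrFun (hbwd P S Q h z) y).symm, fun y => ?_, (hbwd P S Q h z).symm, ?_⟩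
    · rw [h1, h2]
      apply le_antisymm
      · refine le_iInf fun x => ?_
        obtain ⟨r, hr⟩ := hfin x y
        have := hker x y
        rw [hr, EReal.coe_le_coe_iff] at this
        rw [hr, ← EReal.coe_sub, EReal.coe_le_coe_iff]
        linarith
      -- The infimum is attained at the starting point of the optimal backward trajectory: its
      -- payoff, a lower bound for the kernel, already equals the difference of the two values.
      · obtain ⟨u, ξ, hu, rfl, he⟩ := hq.exists_optimal_final ht.le hB12 y
        refine iInf_le_of_le (ξ t₁) ?_
        obtain ⟨r, hr⟩ := hfin (ξ t₁) (ξ t₂)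
        have := hle u ξ hu
        rw [hr, EReal.coe_le_coe_iff] at this
        rw [hr, ← EReal.coe_sub, EReal.coe_le_coe_iff]
        linarith
    · rw [hfwd P S Q h z, hbwd P S Q h z]
  -- The operators keep the data (P, S, Q, z) of a value function and change only its time, so the
  -- remaining claims follow from `hfwd` and `hbwd`.
  · rintro V ⟨P, S, Q, z, h, rfl⟩
    exact ⟨P, S, Q, z, h, hfwd P S Q h z⟩
  · rintro V ⟨P, S, Q, z, h, rfl⟩
    exact ⟨P, S, Q, z, h, hbwd P S Q h z⟩
  · rintro V ⟨P, S, Q, z, h, rfl⟩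
    rw [hfwd P S Q h z, hbwd P S Q h z]
  · rintro V ⟨P, S, Q, z, h, rfl⟩
    rw [hbwd P S Q h z, hfwd P S Q h z]
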